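/- For an integer $n \ge 1$ and $p \in [0,1]$, let $G(n,p)$ be the random graph on the vertex set $V=\{1,\dots,n\}$ in which every pair is an edge with probability $p$, independently. The expected number of cliques of size $x$ in $G(n,p)$ is $E_{n,p}(x)=\binom{n}{x}p^{x(x-1)/2}$, and the expected number of independent sets of size $x$ is $E'_{n,p}(x)=\binom{n}{x}(1-p)^{x(x-1)/2}$; these formulas are extended to real $x\in[0,n]$ by $\binom{n}{x}=\frac{\Gamma(n+1)}{\Gamma(x+1)\Gamma(n-x+1)}$. The clique number $\omega=\omega(n,p)$ of $G(n,p)$ is the largest real $x\in[0,n]$ with $E_{n,p}(x)\ge 1$; if $p>0$ it is the largest solution $x \in [0,n]$ of $E_{n,p}(x)=1$ (if $p=0$ it is $1$). The independence number $\alpha=\alpha(n,p)$ is defined in the same way from $E'_{n,p}$. A cut of $V$ is a pair $(U,V\setminus U)$ with $U \subseteq V$. A family $\mathcal F$ of cuts is a complete $(a,b)$-separator if for all disjoint $A,B\subseteq V$ with $|A|\le a$ and $|B|\le b$ there is a cut $(U,V\setminus U)\in\mathcal F$ with $A\subseteq U$ and $B\subseteq V\setminus U$. Theorem. There is an absolute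 constant $C$ such that for every $n\ge 1$ and every $p\in[0,1]$ (which may depend on $n$) there is a complete $(\omega(n,p),\alpha(n,p))$-separator on $V$ consisting of at most $C n^7$ cuts. -/

import Mathlib

open MeasureTheory ProbabilityTheory

/-- A finite family `F` of cuts of the vertex set `V`, the cut `(U, V \ U)` being represented by its
first side `U`, is a complete `(a, b)`-separator if every pair of disjoint vertex sets `A`, `B` with
`|A| ≤ a` and `|B| ≤ b` is separated by some cut of `F`. -/
def IsCompleteSeparator {V : Type*} [Fintype V] [DecidableEq V]
    (F : Finset (Finset V)) (a b : ℝ) : Prop :=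
  ∀ A B : Finset V, Disjoint A B → (A.card : ℝ) ≤ a → (B.card : ℝ) ≤ b →
    ∃ U ∈ F, A ⊆ U ∧ B ⊆ Uᶜ

/-- The binomial coefficient `n choose x` for real `x` with `0 ≤ x ≤ n`, via the Gamma function. -/
noncomputable def realChoose (n : ℕ) (x : ℝ) : ℝ :=
  Real.Gamma (n + 1) / (Real.Gamma (x + 1) * Real.Gamma (n - x + 1))

/-- The expected number of cliques of size `x` in the random graph `G(n, p)`, namely
`(n choose x) * p ^ (x choose 2)`, as a function of a real `x` with `0 ≤ x ≤ n`;
`integral_card_cliqueSet` shows that it is that expectation when `x` is an integer. -/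
noncomputable def expectedCliques (n : ℕ) (p x : ℝ) : ℝ :=
  realChoose n x * p ^ (x * (x - 1) / 2)

/-- The expected number of independent sets of size `x` in the random graph `G(n, p)`, namely
`(n choose x) * (1 - p) ^ (x choose 2)`, as a function of a real `x` with `0 ≤ x ≤ n`;
`integral_card_indepSetSet` shows that it is that expectation when `x` is an integer. -/
noncomputable def expectedIndepSets (n : ℕ) (p x : ℝ) : ℝ :=
  realChoose n x * (1 - p) ^ (x * (x - 1) / 2)

/-- The clique number `ω` of `G(n, p)`: the largest real `x ∈ [0, n]` at which the expected number
of cliques of size `x` is at least `1`. If `0 < p` it is the largest solution in `[0, n]` of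
"expected number of cliques of size `x` equals `1`" (`isGreatest_cliqueNumber`); if `p = 0` that
equation has no positive solution for `n ≥ 2`, and the value is `1` (`cliqueNumber_zero`). -/
noncomputable def cliqueNumber (n : ℕ) (p : ℝ) : ℝ :=
  sSup {x : ℝ | 0 ≤ x ∧ x ≤ n ∧ 1 ≤ expectedCliques n p x}

/-- The independence number `α` of `G(n, p)`: the largest real `x ∈ [0, n]` at which the expected
number of independent sets of size `x` is at least `1`; if `p < 1` it is the largest solution in
`[0, n]` of "expected number of independent sets of size `x` equals `1`"
(`isGreatest_indepNumber`). -/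
noncomputable def indepNumber (n : ℕ) (p : ℝ) : ℝ :=
  sSup {x : ℝ | 0 ≤ x ∧ x ≤ n ∧ 1 ≤ expectedIndepSets n p x}

theorem expectedIndepSets_eq (n : ℕ) (p x : ℝ) :
    expectedIndepSets n p x = expectedCliques n (1 - p) x := rfl

theorem indepNumber_eq (n : ℕ) (p : ℝ) : indepNumber n p = cliqueNumber n (1 - p) := rfl

theorem realChoose_natCast {n r : ℕ} (h : r ≤ n) : realChoose n r = (n.choose r : ℝ) := by
  rw [realChoose, ← Nat.cast_sub h, Real.Gamma_nat_eq_factorial, Real.Gamma_nat_eq_factorial,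
    Real.Gamma_nat_eq_factorial, Nat.cast_choose ℝ h]

theorem expectedCliques_natCast {n r : ℕ} (h : r ≤ n) (p : ℝ) :
    expectedCliques n p r = n.choose r * p ^ r.choose 2 := by
  rw [expectedCliques, realChoose_natCast h, ← Nat.cast_choose_two, Real.rpow_natCast]

theorem measurableSingletonClass_simpleGraph (n : ℕ) :
    MeasurableSingletonClass (SimpleGraph (Fin n)) := by
  refine ⟨fun G => ?_⟩
  have : ({G} : Set (SimpleGraph (Fin n))) = SimpleGraph.edgeSet ⁻¹' {G.edgeSet} := by
    ext H; simp
  rw [this]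
  exact SimpleGraph.measurableEmbedding_edgeSet.measurable (Set.toFinite _).measurableSet

theorem measure_forall_mem {n : ℕ} (p : unitInterval) (T : Finset (Sym2 (Fin n)))
    (hT : ∀ e ∈ T, ¬ e.IsDiag) :
    (SimpleGraph.binomialRandom (Fin n) p).real {G | ∀ e ∈ T, e ∈ G.edgeSet}
        = (p : ℝ) ^ T.card ∧
      (SimpleGraph.binomialRandom (Fin n) p).real {G | ∀ e ∈ T, e ∉ G.edgeSet}
        = (1 - p : ℝ) ^ T.card := by
  have := measurableSingletonClass_simpleGraph n
  have key : ∀ q : Prop, (SimpleGraph.binomialRandom (Fin n) p)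
      {G | ∀ e ∈ T, (e ∈ G.edgeSet) = q} = ∏ e ∈ T, (unitInterval.toNNReal p •
        Measure.dirac (e ∈ Sym2.diagSetᶜ) + unitInterval.toNNReal (unitInterval.symm p) •
          Measure.dirac False : Measure Prop) {q} := by
    intro q
    rw [SimpleGraph.binomialRandom_eq_map, Measure.map_apply
      SimpleGraph.measurable_fromEdgeSet (Set.toFinite _).measurableSet, setBernoulli_apply',
      ← Measure.infinitePi_pi _ (fun _ _ => MeasurableSet.singleton q)]
    congr 1
    ext f
    simp only [Set.mem_preimage, Set.mem_ofPred_eq, SimpleGraph.edgeSet_fromEdgeSet, Set.mem_pi,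
      Set.mem_sdiff, Finset.mem_coe, Set.mem_singleton_iff]
    refine forall₂_congr fun e he => ?_
    have := hT e he
    simp [this]
  constructor
  · have := key True
    simp only [eq_iff_iff, iff_true] at this
    rw [measureReal_def, this, Finset.prod_congr rfl (g := fun _ => (unitInterval.toNNReal p : ENNReal))]
    · simp
    · intro e he
      have := hT e he
      simp [this, Set.indicator]
  · have := key False
    simp only [eq_iff_iff, iff_false] at this
    rw [measureReal_def, this, Finset.prod_congr rfl
      (g := fun _ => (unitInterval.toNNReal (unitInterval.symm p) : ENNReal))]
    · simp
    · intro e he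
      have := hT e he
      simp [this, Set.indicator]

theorem integral_ncard_subsets {n : ℕ} (p : unitInterval) (r : ℕ) (c : ℝ)
    (P : SimpleGraph (Fin n) → Finset (Fin n) → Prop)
    (hP : ∀ s : Finset (Fin n), s.card = r →
      (SimpleGraph.binomialRandom (Fin n) p).real {G | P G s} = c) :
    ∫ G, (({s | P G s ∧ s.card = r} : Set (Finset (Fin n))).ncard : ℝ)
        ∂(SimpleGraph.binomialRandom (Fin n) p) = n.choose r * c := by
  classical
  have := measurableSingletonClass_simpleGraph n
  have h1 : ∀ G : SimpleGraph (Fin n),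
      (({s | P G s ∧ s.card = r} : Set (Finset (Fin n))).ncard : ℝ)
        = ∑ s ∈ Finset.powersetCard r Finset.univ, Set.indicator {G | P G s} 1 G := by
    intro G
    have : ({s | P G s ∧ s.card = r} : Set (Finset (Fin n)))
        = ((Finset.powersetCard r Finset.univ).filter (fun s => P G s) : Finset _) := by
      ext s; simp [and_comm]
    rw [this, Set.ncard_coe_finset, Finset.card_filter]
    simp [Set.indicator]
  simp_rw [h1]
  rw [integral_finsetSum _ (fun s _ => Integrable.of_finite)]
  rw [Finset.sum_congr rfl (g := fun _ => c)]
  · simp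
  · intro s hs
    rw [integral_indicator_one (Set.toFinite _).measurableSet]
    exact hP s (Finset.mem_powersetCard.1 hs).2

theorem integral_card_cliqueSet {n r : ℕ} (h : r ≤ n) (p : unitInterval) :
    ∫ G, ((G.cliqueSet r).ncard : ℝ) ∂(SimpleGraph.binomialRandom (Fin n) p)
      = expectedCliques n p r := by
  rw [expectedCliques_natCast h, ← integral_ncard_subsets p r _ (fun G s => G.IsClique s)]
  · simp only [SimpleGraph.cliqueSet, SimpleGraph.isNClique_iff]
  · intro s hs
    rw [← hs, ← Sym2.card_image_offDiag,
      ← (measure_forall_mem p (s.offDiag.image Sym2.mk.uncurry) (by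
        intro e he
        obtain ⟨⟨a, b⟩, hab, rfl⟩ := Finset.mem_image.1 he
        simpa using (Finset.mem_offDiag.1 hab).2.2)).1]
    congr 1
    ext G
    simp only [Set.mem_ofPred_eq, Finset.mem_image, Finset.mem_offDiag, Prod.exists,
      SimpleGraph.isClique_iff, Set.Pairwise, Finset.mem_coe]
    constructor
    · rintro h e ⟨a, b, ⟨ha, hb, hab⟩, rfl⟩
      exact h ha hb hab
    · intro h a ha b hb hab
      exact h _ ⟨a, b, ⟨ha, hb, hab⟩, rfl⟩

theorem integral_card_indepSetSet {n r : ℕ} (h : r ≤ n) (p : unitInterval) :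
    ∫ G, ((G.indepSetSet r).ncard : ℝ) ∂(SimpleGraph.binomialRandom (Fin n) p)
      = expectedIndepSets n p r := by
  rw [expectedIndepSets_eq, expectedCliques_natCast h,
    ← integral_ncard_subsets p r _ (fun G s => G.IsIndepSet s)]
  · simp only [SimpleGraph.indepSetSet, SimpleGraph.isNIndepSet_iff]
  · intro s hs
    rw [← hs, ← Sym2.card_image_offDiag,
      ← (measure_forall_mem p (s.offDiag.image Sym2.mk.uncurry) (by
        intro e he
        obtain ⟨⟨a, b⟩, hab, rfl⟩ := Finset.mem_image.1 he
        simpa using (Finset.mem_offDiag.1 hab).2.2)).2]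
    congr 1
    ext G
    simp only [Set.mem_ofPred_eq, Finset.mem_image, Finset.mem_offDiag, Prod.exists,
      SimpleGraph.isIndepSet_iff, Set.Pairwise, Finset.mem_coe]
    constructor
    · rintro h e ⟨a, b, ⟨ha, hb, hab⟩, rfl⟩
      exact h ha hb hab
    · intro h a ha b hb hab
      exact h _ ⟨a, b, ⟨ha, hb, hab⟩, rfl⟩

theorem continuousOn_expectedCliques (n : ℕ) {p : ℝ} (hp : 0 < p) :
    ContinuousOn (expectedCliques n p) (Set.Icc 0 n) := by
  have hG : ∀ y : ℝ, 0 < y → ContinuousAt Real.Gamma y := fun y hy =>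
    (Real.differentiableAt_Gamma fun m => by
      have : (0 : ℝ) ≤ m := m.cast_nonneg
      linarith).continuousAt
  intro x hx
  have h1 : 0 < x + 1 := by linarith [hx.1]
  have h2 : 0 < (n : ℝ) - x + 1 := by linarith [hx.2]
  have c1 : ContinuousAt (fun x : ℝ => Real.Gamma (x + 1)) x :=
    ContinuousAt.comp (f := fun x : ℝ => x + 1) (hG _ h1) (by fun_prop)
  have c2 : ContinuousAt (fun x : ℝ => Real.Gamma ((n : ℝ) - x + 1)) x :=
    ContinuousAt.comp (f := fun x : ℝ => (n : ℝ) - x + 1) (hG _ h2) (by fun_prop)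
  have c3 : ContinuousAt (fun x : ℝ => p ^ (x * (x - 1) / 2)) x :=
    ContinuousAt.rpow (by fun_prop) (by fun_prop) (Or.inl hp.ne')
  exact ((continuousAt_const.div (c1.mul c2)
    (mul_pos (Real.Gamma_pos_of_pos h1) (Real.Gamma_pos_of_pos h2)).ne').mul c3).continuousWithinAt

theorem isGreatest_cliqueNumber (n : ℕ) {p : ℝ} (hp : 0 < p) (hp1 : p ≤ 1) :
    IsGreatest {x : ℝ | 0 ≤ x ∧ x ≤ n ∧ expectedCliques n p x = 1} (cliqueNumber n p) := by
  set S : Set ℝ := {x : ℝ | 0 ≤ x ∧ x ≤ n ∧ 1 ≤ expectedCliques n p x} with hS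
  have hcont := continuousOn_expectedCliques n hp
  have hSeq : S = Set.Icc (0 : ℝ) n ∩ expectedCliques n p ⁻¹' Set.Ici 1 := by
    ext x; simp [hS, and_assoc]
  have hclosed : IsClosed S := by
    rw [hSeq]; exact hcont.preimage_isClosed_of_isClosed isClosed_Icc isClosed_Ici
  have hbdd : BddAbove S := ⟨n, fun x hx => hx.2.1⟩
  have h0 : (0 : ℝ) ∈ S := by
    refine ⟨le_rfl, n.cast_nonneg, ?_⟩
    have := expectedCliques_natCast (Nat.zero_le n) p
    simp only [Nat.cast_zero] at this
    simp [this]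
  have hmem : cliqueNumber n p ∈ S := hclosed.csSup_mem ⟨0, h0⟩ hbdd
  have hn : expectedCliques n p n ≤ 1 := by
    rw [expectedCliques_natCast le_rfl]
    simpa using pow_le_one₀ hp.le hp1
  constructor
  · refine ⟨hmem.1, hmem.2.1, ?_⟩
    obtain ⟨y, hy, hy1⟩ := intermediate_value_Icc' hmem.2.1
      (hcont.mono (Set.Icc_subset_Icc_left hmem.1)) ⟨hn, hmem.2.2⟩
    have : y ≤ cliqueNumber n p := le_csSup hbdd ⟨hmem.1.trans hy.1, hy.2, hy1.ge⟩
    rwa [le_antisymm hy.1 this]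
  · intro x hx
    exact le_csSup hbdd ⟨hx.1, hx.2.1, hx.2.2.ge⟩

theorem isGreatest_indepNumber (n : ℕ) {p : ℝ} (hp : 0 ≤ p) (hp1 : p < 1) :
    IsGreatest {x : ℝ | 0 ≤ x ∧ x ≤ n ∧ expectedIndepSets n p x = 1} (indepNumber n p) :=
  isGreatest_cliqueNumber n (p := 1 - p) (by linarith) (by linarith)

theorem cliqueNumber_zero {n : ℕ} (hn : 1 ≤ n) : cliqueNumber n 0 = 1 := by
  refine IsGreatest.csSup_eq ⟨⟨zero_le_one, by exact_mod_cast hn, ?_⟩, ?_⟩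
  · have := expectedCliques_natCast hn 0
    simp only [Nat.cast_one] at this
    simpa [this] using hn
  · intro x hx
    by_contra! h
    have h2 := hx.2.2
    rw [expectedCliques, Real.zero_rpow (by
      have : 0 < x * (x - 1) := mul_pos (by linarith) (by linarith)
      linarith)] at h2
    norm_num at h2

theorem indepNumber_one {n : ℕ} (hn : 1 ≤ n) : indepNumber n 1 = 1 := by
  rw [indepNumber_eq, sub_self, cliqueNumber_zero hn]

/-! Since `realChoose n x ≤ n ^ x`, the equation `E(ω) = 1` gives `1 ≤ (n * p ^ ((ω - 1) / 2)) ^ ω`,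
hence `p ^ ω ≥ p / n ^ 2`; symmetrically `(1 - p) ^ α ≥ (1 - p) / n ^ 2`. Put each vertex in `U`
independently with probability `p`. If `p` and `1 - p` are both at least `1 / n`, this random cut
separates a given admissible pair with probability at least `n ^ (-6)`. If `p < 1 / n`, cliques have
at most 3 vertices and bias `1 / (2 * n)` works; `p > 1 - 1 / n` is symmetric. There are at most `4
^ n` pairs, so repeated averaging (`exists_hitting_set`) yields `O(n ^ 7)` cuts separating all of
them. -/

/-! ### Size bounds from the first moment -/

/-- By log-convexity, the Gamma function grows by a factor at most `n ^ x` on `[n + 1 - x, n + 1]`. -/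
theorem Gamma_add_one_le_rpow_mul {n : ℕ} {x : ℝ} (h1 : 1 ≤ x) (hx : x ≤ n) :
    Real.Gamma (n + 1) ≤ (n : ℝ) ^ x * Real.Gamma (n - x + 1) := by
  have hn : (0 : ℝ) < n := by linarith
  have hb : 0 < Real.Gamma (n - x + 1) := Real.Gamma_pos_of_pos (by linarith)
  have hc : 0 < Real.Gamma (n : ℝ) := Real.Gamma_pos_of_pos hn
  rcases h1.eq_or_lt with rfl | h1
  · rw [Real.rpow_one, Real.Gamma_add_one hn.ne', sub_add_cancel]
  -- The slope of `log Γ` on `[n, n + 1]` is `log n` and bounds the slope on `[n - x + 1, n]`, an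
  -- interval that degenerates when `x = 1`.
  have hlog := Real.convexOn_log_Gamma.slope_mono_adjacent
    (x := (n : ℝ) - x + 1) (y := n) (z := n + 1)
    (by simp only [Set.mem_Ioi]; linarith) (by simp only [Set.mem_Ioi]; linarith)
    (by linarith) (by linarith)
  simp only [Function.comp_apply] at hlog
  rw [Real.Gamma_add_one hn.ne', Real.log_mul hn.ne' hc.ne', add_sub_cancel_left,
    div_one, add_sub_cancel_right, div_le_iff₀ (by linarith)] at hlog
  rw [← Real.log_le_log_iff (Real.Gamma_pos_of_pos (by linarith)) (by positivity),
    Real.log_mul (by positivity) hb.ne', Real.log_rpow hn, Real.Gamma_add_one hn.ne',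
    Real.log_mul hn.ne' hc.ne']
  linarith

theorem realChoose_le_rpow {n : ℕ} {x : ℝ} (h1 : 1 ≤ x) (hx : x ≤ n) :
    realChoose n x ≤ (n : ℝ) ^ x := by
  have hb : 0 < Real.Gamma (n - x + 1) := Real.Gamma_pos_of_pos (by linarith)
  have hg : 1 ≤ Real.Gamma (x + 1) := by
    refine Real.Gamma_two.symm.le.trans ?_
    exact Real.Gamma_strictMonoOn_Ici.monotoneOn (Set.mem_Ici.2 le_rfl)
      (Set.mem_Ici.2 (by linarith)) (by linarith)
  rw [realChoose, div_le_iff₀ (by positivity)]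
  refine (Gamma_add_one_le_rpow_mul h1 hx).trans ?_
  gcongr
  exact le_mul_of_one_le_left hb.le hg

theorem one_le_cliqueNumber {n : ℕ} (hn : 1 ≤ n) (p : ℝ) : 1 ≤ cliqueNumber n p := by
  refine le_csSup ⟨n, fun x hx => hx.2.1⟩ ⟨zero_le_one, by exact_mod_cast hn, ?_⟩
  have := expectedCliques_natCast hn p
  simp only [Nat.cast_one] at this
  simpa [this] using hn

/-- If `k` is at most the clique number of `G(n, p)`, then `p ^ k` is at least `p / n ^ 2`. -/
theorem le_sq_mul_pow_of_le_cliqueNumber {n : ℕ} (hn : 1 ≤ n) {p : ℝ} (hp : 0 ≤ p) (hp1 : p ≤ 1)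
    {k : ℕ} (hk : (k : ℝ) ≤ cliqueNumber n p) : p ≤ (n : ℝ) ^ 2 * p ^ k := by
  rcases hp.eq_or_lt with rfl | hp
  · positivity
  obtain ⟨⟨-, hωn, hω⟩, -⟩ := isGreatest_cliqueNumber n hp hp1
  have hω1 := one_le_cliqueNumber hn p
  set ω := cliqueNumber n p
  have hn0 : (0 : ℝ) < n := by exact_mod_cast hn
  have h1 : 1 ≤ ((n : ℝ) * p ^ ((ω - 1) / 2)) ^ ω := by
    rw [Real.mul_rpow hn0.le (by positivity), ← Real.rpow_mul hp.le,
      show (ω - 1) / 2 * ω = ω * (ω - 1) / 2 by ring]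
    refine hω.symm.le.trans ?_
    rw [expectedCliques]
    gcongr
    exact realChoose_le_rpow hω1 hωn
  -- Take the `ω`-th root, as `ω > 0`.
  have h2 : 1 ≤ (n : ℝ) * p ^ ((ω - 1) / 2) := by
    by_contra! h
    exact h1.not_gt (Real.rpow_lt_one (by positivity) h (by linarith))
  have h3 : 1 ≤ (n : ℝ) ^ 2 * p ^ (ω - 1) := by
    calc (1 : ℝ) ≤ ((n : ℝ) * p ^ ((ω - 1) / 2)) ^ 2 := one_le_pow₀ h2
      _ = _ := by
        rw [mul_pow, ← Real.rpow_natCast (p ^ _), ← Real.rpow_mul hp.le]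
        congr 2
        push_cast
        ring
  calc p ≤ (n : ℝ) ^ 2 * p ^ (ω - 1) * p := le_mul_of_one_le_left hp.le h3
    _ = (n : ℝ) ^ 2 * p ^ ω := by
      rw [mul_assoc, ← Real.rpow_add_one hp.ne', sub_add_cancel]
    _ ≤ (n : ℝ) ^ 2 * p ^ k := by
      rw [← Real.rpow_natCast p k]
      gcongr ?_ * ?_
      exact Real.rpow_le_rpow_of_exponent_ge hp hp1 hk

/-- If `k ≥ 4` then `p ≤ n ^ 2 * p ^ 4 = (n * p) ^ 2 * p ^ 2 < p ^ 2 < p`, which is absurd. -/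
theorem le_three_of_le_cliqueNumber {n : ℕ} (hn : 1 ≤ n) {p : ℝ} (hp : 0 ≤ p)
    (hpn : n * p < 1) {k : ℕ} (hk : (k : ℝ) ≤ cliqueNumber n p) : k ≤ 3 := by
  have hn1 : (1 : ℝ) ≤ n := by exact_mod_cast hn
  rcases hp.eq_or_lt with rfl | hp
  · rw [cliqueNumber_zero hn] at hk
    have : k ≤ 1 := by exact_mod_cast hk
    omega
  have hp1 : p < 1 := lt_of_le_of_lt (le_mul_of_one_le_left hp.le hn1) hpn
  by_contra! h
  have h1 := le_sq_mul_pow_of_le_cliqueNumber hn hp.le hp1.le hk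
  have h2 : (n : ℝ) ^ 2 * p ^ k ≤ (n : ℝ) ^ 2 * p ^ 4 := by
    gcongr ?_ * ?_
    exact pow_le_pow_of_le_one hp.le hp1.le h
  have h3 : (n * p) ^ 2 < 1 := pow_lt_one₀ (by positivity) hpn two_ne_zero
  have h4 : (n : ℝ) ^ 2 * p ^ 4 = (n * p) ^ 2 * (p * p) := by ring
  have h5 : (n * p) ^ 2 * (p * p) < 1 * (p * p) := by gcongr
  have h6 : p * p < p := mul_lt_of_lt_one_left hp hp1
  linarith

/-! ### Choice of the bias -/

/-- Bernoulli's inequality gives `(1 - 1 / (2 * n)) ^ n ≥ 1 / 2`, while the other factor is at least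
`1 / (8 * n ^ 3)`. The power 6 is a weakening that matches the dense case. -/
theorem sparse_pow_mul_pow_ge {n : ℕ} (hn : 1 ≤ n) {a b : ℕ} (ha : a ≤ 3) (hb : b ≤ n) :
    1 / (16 * (n : ℝ) ^ 6) ≤ (1 / (2 * n) : ℝ) ^ a * (1 - 1 / (2 * n)) ^ b := by
  have hn1 : (1 : ℝ) ≤ n := by exact_mod_cast hn
  have hq0 : (0 : ℝ) ≤ 1 / (2 * n) := by positivity
  have hq1 : 1 / (2 * n : ℝ) ≤ 1 := by rw [div_le_one (by positivity)]; linarith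
  have h1 : (1 / 2 : ℝ) ≤ (1 - 1 / (2 * n)) ^ b := by
    have h := one_add_mul_le_pow (a := -(1 / (2 * n : ℝ))) (by linarith) n
    rw [← sub_eq_add_neg] at h
    refine le_trans (le_trans (le_of_eq ?_) h)
      (pow_le_pow_of_le_one (by linarith) (by linarith) hb)
    field_simp
    norm_num
  have h2 : 1 / (8 * (n : ℝ) ^ 6) ≤ (1 / (2 * n) : ℝ) ^ a := by
    refine le_trans ?_ (pow_le_pow_of_le_one hq0 hq1 ha)
    rw [div_pow, one_pow, mul_pow]
    norm_num only
    gcongr 1 / (8 * ?_)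
    exact pow_le_pow_right₀ hn1 (by norm_num)
  calc 1 / (16 * (n : ℝ) ^ 6) = 1 / (8 * (n : ℝ) ^ 6) * (1 / 2) := by field_simp; norm_num
    _ ≤ _ := by gcongr

/-- There is a bias `q` for which a random cut separates any given pair of sets of sizes at most the
clique number and the independence number with probability at least `1 / (16 * n ^ 6)`. -/
theorem exists_bias {n : ℕ} (hn : 1 ≤ n) {p : ℝ} (hp : 0 ≤ p) (hp1 : p ≤ 1) :
    ∃ q : ℝ, 0 ≤ q ∧ q ≤ 1 ∧ ∀ a b : ℕ, a ≤ n → b ≤ n → (a : ℝ) ≤ cliqueNumber n p →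
      (b : ℝ) ≤ indepNumber n p → 1 / (16 * (n : ℝ) ^ 6) ≤ q ^ a * (1 - q) ^ b := by
  have hn1 : (1 : ℝ) ≤ n := by exact_mod_cast hn
  have hq0 : (0 : ℝ) ≤ 1 / (2 * n) := by positivity
  have hq1 : 1 / (2 * n : ℝ) ≤ 1 := by rw [div_le_one (by positivity)]; linarith
  rcases lt_or_ge (n * p) 1 with h | h
  · exact ⟨1 / (2 * n), hq0, hq1, fun a b _ hb ha' _ =>
      sparse_pow_mul_pow_ge hn (le_three_of_le_cliqueNumber hn hp h ha') hb⟩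
  rcases lt_or_ge (n * (1 - p)) 1 with h' | h'
  · refine ⟨1 - 1 / (2 * n), by linarith, by linarith, fun a b ha _ _ hb' => ?_⟩
    rw [indepNumber_eq] at hb'
    rw [sub_sub_cancel, mul_comm (_ ^ a)]
    exact sparse_pow_mul_pow_ge hn
      (le_three_of_le_cliqueNumber hn (sub_nonneg.2 hp1) h' hb') ha
  -- Each of the two estimates costs `n ^ 2`, and each of `p, 1 - p ≥ 1 / n` costs another `n`: in
  -- all `n ^ 6`.
  · refine ⟨p, hp, hp1, fun a b _ _ ha hb => ?_⟩
    rw [indepNumber_eq] at hb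
    have h1 := le_sq_mul_pow_of_le_cliqueNumber hn hp hp1 ha
    have h2 := le_sq_mul_pow_of_le_cliqueNumber hn (sub_nonneg.2 hp1) (by linarith) hb
    have hq : 0 ≤ 1 - p := sub_nonneg.2 hp1
    rw [div_le_iff₀ (by positivity)]
    calc (1 : ℝ) ≤ n * p * (n * (1 - p)) := one_le_mul_of_one_le_of_one_le h h'
      _ ≤ n * ((n : ℝ) ^ 2 * p ^ a) * (n * ((n : ℝ) ^ 2 * (1 - p) ^ b)) := by gcongr
      _ = p ^ a * (1 - p) ^ b * (n : ℝ) ^ 6 := by ring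
      _ ≤ p ^ a * (1 - p) ^ b * (16 * (n : ℝ) ^ 6) := by
        gcongr
        exact le_mul_of_one_le_left (by positivity) (by norm_num)

/-! ### Random cuts and greedy covering -/

/-- The probability that a random vertex set, containing each vertex independently with probability
`q`, contains `A` and avoids `B`. -/
theorem sum_separating_weight {V : Type*} [Fintype V] [DecidableEq V] (q : ℝ) {A B : Finset V}
    (h : Disjoint A B) :
    ∑ U : Finset V, (if A ⊆ U ∧ B ⊆ Uᶜ then q ^ U.card * (1 - q) ^ Uᶜ.card else 0)
      = q ^ A.card * (1 - q) ^ B.card := by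
  -- Expanding the product over vertices gives one term per `U`. Inside weights vanish on `B` and
  -- outside weights on `A`, so only separating `U` survive; a vertex in neither set contributes `q
  -- + (1 - q) = 1`.
  have key := Finset.prod_add (fun i => if i ∈ B then 0 else q)
    (fun i => if i ∈ A then 0 else 1 - q) (Finset.univ : Finset V)
  have hL : ∏ i : V, ((if i ∈ B then 0 else q) + (if i ∈ A then 0 else 1 - q))
      = q ^ A.card * (1 - q) ^ B.card := by
    rw [← Finset.prod_const, ← Finset.prod_const, ← Finset.prod_ite_mem_eq A,
      ← Finset.prod_ite_mem_eq B, ← Finset.prod_mul_distrib]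
    refine Finset.prod_congr rfl fun i _ => ?_
    by_cases hA : i ∈ A
    · simp [hA, Finset.disjoint_left.1 h hA]
    · by_cases hB : i ∈ B <;> simp [hA, hB]
  rw [← hL, key, Finset.powerset_univ]
  refine Finset.sum_congr rfl fun U _ => ?_
  rw [← Finset.compl_eq_univ_sdiff]
  split_ifs with hU
  · rw [← Finset.prod_const, ← Finset.prod_const]
    congr 1
    · exact Finset.prod_congr rfl fun i hi =>
        (if_neg fun hB => Finset.mem_compl.1 (hU.2 hB) hi).symm
    · exact Finset.prod_congr rfl fun i hi =>
        (if_neg fun hA => Finset.mem_compl.1 hi (hU.1 hA)).symm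
  · symm
    rw [not_and_or, Finset.not_subset, Finset.not_subset] at hU
    rcases hU with ⟨i, hA, hi⟩ | ⟨i, hB, hi⟩
    · exact mul_eq_zero_of_right _ (Finset.prod_eq_zero (Finset.mem_compl.2 hi) (if_pos hA))
    · have hU : i ∈ U := by simpa using hi
      refine mul_eq_zero_of_left ?_ _
      exact Finset.prod_eq_zero hU (by rw [if_pos hB])

/-- If every element of `P` is hit by a `w`-random `u` with probability at least `δ`, then some `u`
leaves at most a proportion `1 - δ` of `P` unhit. -/
theorem exists_card_unhit_le {α β : Type*} [Fintype α] (r : α → β → Prop)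
    [∀ u x, Decidable (r u x)] {w : α → ℝ} (hw : ∀ u, 0 ≤ w u) (hw1 : ∑ u, w u = 1) {δ : ℝ}
    (P : Finset β) (hP : ∀ x ∈ P, δ ≤ ∑ u, if r u x then w u else 0) :
    ∃ u, ((P.filter fun x => ¬ r u x).card : ℝ) ≤ (1 - δ) * P.card := by
  by_contra! h
  have h1 : ∑ u, w u * ((P.filter fun x => ¬ r u x).card : ℝ) ≤ (1 - δ) * P.card := by
    simp_rw [Finset.card_filter, Nat.cast_sum, Finset.mul_sum]
    rw [Finset.sum_comm, mul_comm, ← nsmul_eq_mul]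
    refine Finset.sum_le_card_nsmul _ _ _ fun x hx => ?_
    have : ∑ u, w u * (((if ¬ r u x then 1 else 0 : ℕ)) : ℝ)
        = 1 - ∑ u, if r u x then w u else 0 := by
      rw [← hw1, ← Finset.sum_sub_distrib]
      refine Finset.sum_congr rfl fun u _ => ?_
      split_ifs <;> simp_all
    rw [this]
    linarith [hP x hx]
  -- A point of positive weight makes the averaged inequality strict.
  obtain ⟨v, hv⟩ : ∃ v, 0 < w v := by
    by_contra! hc
    have := Finset.sum_nonpos fun u (_ : u ∈ Finset.univ) => hc u
    linarith
  have h2 : ∑ u, w u * ((1 - δ) * P.card)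
      < ∑ u, w u * ((P.filter fun x => ¬ r u x).card : ℝ) :=
    Finset.sum_lt_sum (fun u _ => mul_le_mul_of_nonneg_left (h u).le (hw u))
      ⟨v, Finset.mem_univ _, mul_lt_mul_of_pos_left (h v) hv⟩
  rw [← Finset.sum_mul, hw1, one_mul] at h2
  linarith

/-- Greedy choice: the hitting hypothesis passes to the still unhit part of `P`, so every new
element shrinks that part by a factor `1 - δ`. -/
theorem exists_small_unhit {α β : Type*} [Fintype α] [DecidableEq α] (r : α → β → Prop)
    [∀ u x, Decidable (r u x)] {w : α → ℝ} (hw : ∀ u, 0 ≤ w u) (hw1 : ∑ u, w u = 1) {δ : ℝ}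
    (hδ : δ ≤ 1) (P : Finset β) (hP : ∀ x ∈ P, δ ≤ ∑ u, if r u x then w u else 0) (t : ℕ) :
    ∃ F : Finset α, F.card ≤ t ∧
      ((P.filter fun x => ∀ u ∈ F, ¬ r u x).card : ℝ) ≤ (1 - δ) ^ t * P.card := by
  induction t with
  | zero => exact ⟨∅, by simp⟩
  | succ t ih =>
    obtain ⟨F, hF, hc⟩ := ih
    obtain ⟨u, hu⟩ := exists_card_unhit_le r hw hw1 (P.filter fun x => ∀ u ∈ F, ¬ r u x)
      fun x hx => hP x (Finset.mem_filter.1 hx).1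
    refine ⟨insert u F, (Finset.card_insert_le _ _).trans (by omega), ?_⟩
    have he : (P.filter fun x => ∀ v ∈ insert u F, ¬ r v x)
        = (P.filter fun x => ∀ v ∈ F, ¬ r v x).filter fun x => ¬ r u x := by
      ext x
      simp only [Finset.mem_filter, Finset.forall_mem_insert]
      tauto
    rw [he, pow_succ', mul_assoc]
    exact hu.trans (mul_le_mul_of_nonneg_left hc (sub_nonneg.2 hδ))

theorem exists_hitting_set {α β : Type*} [Fintype α] [DecidableEq α] (r : α → β → Prop)
    {w : α → ℝ} (hw : ∀ u, 0 ≤ w u) (hw1 : ∑ u, w u = 1) {δ : ℝ}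
    (hδ : δ ≤ 1) (P : Finset β) [∀ u x, Decidable (r u x)]
    (hP : ∀ x ∈ P, δ ≤ ∑ u, if r u x then w u else 0) {t : ℕ} (ht : (1 - δ) ^ t * P.card < 1) :
    ∃ F : Finset α, F.card ≤ t ∧ ∀ x ∈ P, ∃ u ∈ F, r u x := by
  obtain ⟨F, hF, hc⟩ := exists_small_unhit r hw hw1 hδ P hP t
  refine ⟨F, hF, fun x hx => ?_⟩
  by_contra! h
  have h0 : (P.filter fun x => ∀ u ∈ F, ¬ r u x).card < 1 := by exact_mod_cast hc.trans_lt ht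
  exact (Finset.card_pos.2 ⟨x, Finset.mem_filter.2 ⟨hx, h⟩⟩).ne' (Nat.lt_one_iff.1 h0)

/-- As `1 - δ ≤ exp (-δ)` and `32 * n ^ 7 / (16 * n ^ 6) = 2 * n`, the product is at most `(4 / e ^
2) ^ n`; the constant 32 is chosen so that `e ^ 2 > 4` suffices. -/
theorem one_sub_pow_mul_four_pow_lt_one {n : ℕ} (hn : 1 ≤ n) :
    (1 - 1 / (16 * (n : ℝ) ^ 6)) ^ (32 * n ^ 7) * (4 : ℝ) ^ n < 1 := by
  have hn1 : (1 : ℝ) ≤ n := by exact_mod_cast hn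
  have hδ : 1 / (16 * (n : ℝ) ^ 6) ≤ 1 := by
    rw [div_le_one (by positivity)]
    nlinarith [one_le_pow₀ hn1 (n := 6)]
  have he : Real.exp (-2) * 4 < 1 := by
    have h := Real.exp_one_gt_d9
    rw [Real.exp_neg, inv_mul_lt_iff₀ (Real.exp_pos _), show (2 : ℝ) = 1 + 1 by norm_num,
      Real.exp_add]
    nlinarith
  calc (1 - 1 / (16 * (n : ℝ) ^ 6)) ^ (32 * n ^ 7) * (4 : ℝ) ^ n
      ≤ Real.exp (-(1 / (16 * (n : ℝ) ^ 6))) ^ (32 * n ^ 7) * (4 : ℝ) ^ n := by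
        gcongr
        exact Real.one_sub_le_exp_neg _
    _ = (Real.exp (-2) * 4) ^ n := by
        rw [← Real.exp_nat_mul, mul_pow, ← Real.exp_nat_mul]
        congr 2
        push_cast
        field_simp
        norm_num
    _ < 1 := pow_lt_one₀ (by positivity) he (by omega)

theorem mainTheorem7 :
    ∃ C : ℝ, ∀ n : ℕ, 1 ≤ n → ∀ p : ℝ, 0 ≤ p → p ≤ 1 →
      ∃ F : Finset (Finset (Fin n)),
        IsCompleteSeparator F (cliqueNumber n p) (indepNumber n p) ∧
          (F.card : ℝ) ≤ C * (n : ℝ) ^ 7 := by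
  classical
  refine ⟨32, fun n hn p hp hp1 => ?_⟩
  obtain ⟨q, hq0, hq1, hq⟩ := exists_bias hn hp hp1
  have hn1 : (1 : ℝ) ≤ n := by exact_mod_cast hn
  have hδ : 1 / (16 * (n : ℝ) ^ 6) ≤ 1 := by
    rw [div_le_one (by positivity)]
    nlinarith [one_le_pow₀ hn1 (n := 6)]
  let P : Finset (Finset (Fin n) × Finset (Fin n)) := Finset.univ.filter fun x =>
    Disjoint x.1 x.2 ∧ (x.1.card : ℝ) ≤ cliqueNumber n p ∧ (x.2.card : ℝ) ≤ indepNumber n p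
  have hPcard : (P.card : ℝ) ≤ 4 ^ n := by
    have h : P.card ≤ 2 ^ n * 2 ^ n := (Finset.card_le_univ P).trans (by simp)
    rw [← mul_pow] at h
    exact_mod_cast h
  obtain ⟨F, hF, hsep⟩ := exists_hitting_set
    (fun (U : Finset (Fin n)) x => x.1 ⊆ U ∧ x.2 ⊆ Uᶜ)
    (w := fun U => q ^ U.card * (1 - q) ^ Uᶜ.card)
    (fun U => mul_nonneg (pow_nonneg hq0 _) (pow_nonneg (sub_nonneg.2 hq1) _))
    -- The case `A = B = ∅` says that the weights sum to 1.
    (by simpa using sum_separating_weight q (Finset.disjoint_empty_left (∅ : Finset (Fin n))))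
    hδ P (fun x hx => by
      obtain ⟨hd, hA, hB⟩ := (Finset.mem_filter.1 hx).2
      rw [sum_separating_weight q hd]
      exact hq _ _ (by simpa using Finset.card_le_univ x.1) (by simpa using Finset.card_le_univ x.2)
        hA hB)
    (t := 32 * n ^ 7)
    ((mul_le_mul_of_nonneg_left hPcard (pow_nonneg (sub_nonneg.2 hδ) _)).trans_lt
      (one_sub_pow_mul_four_pow_lt_one hn))
  refine ⟨F, fun A B hd hA hB =>
    hsep (A, B) (Finset.mem_filter.2 ⟨Finset.mem_univ _, hd, hA, hB⟩), ?_⟩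
  exact_mod_cast hF
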